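/- Let $\xi_1,\xi_2,\ldots$ be a sequence of integrable real random variables on a probability space. Two integrable random vectors $\eta,\eta^*$ in $\mathbb{R}^d$ are called zonoid equivalent if $\mathbb{E}|\langle u,\eta\rangle|=\mathbb{E}|\langle u,\eta^*\rangle|$ for all $u\in\mathbb{R}^d$. The sequence is called swap-invariant if, for every finite subsequence $(\xi_{k_1},\ldots,\xi_{k_d})$ with $k_1<\cdots<k_d$, all random vectors obtained from it by permuting its coordinates are zonoid equivalent. If $\xi_1,\xi_2,\ldots$ is swap-invariant, then there is an integrable random variable $X$ such that $n^{-1}(\xi_1+\cdots+\xi_n)\to X$ almost surely as $n\to\infty$. -/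

import Mathlib

open MeasureTheory Filter Topology

/-- A random vector `ξ` in `ℝ^d` is integrable if all its coordinates are. -/
def IntegrableVector {Ω : Type*} [MeasurableSpace Ω] {d : ℕ}
    (ξ : Ω → Fin d → ℝ) (P : Measure Ω) : Prop :=
  ∀ i, Integrable (fun ω => ξ ω i) P

/-- Two integrable random vectors `ξ`, `ξ'` in `ℝ^d`, possibly defined on different probability
spaces, are zonoid equivalent if `E|⟨u, ξ⟩| = E|⟨u, ξ'⟩|` for all `u ∈ ℝ^d`. -/
structure ZonoidEquivalent {Ω Ω' : Type*} [MeasurableSpace Ω] [MeasurableSpace Ω'] {d : ℕ}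
    (ξ : Ω → Fin d → ℝ) (P : Measure Ω) (ξ' : Ω' → Fin d → ℝ) (P' : Measure Ω') : Prop where
  integrable_left : IntegrableVector ξ P
  integrable_right : IntegrableVector ξ' P'
  integral_abs_eq : ∀ u : Fin d → ℝ, ∫ ω, |u ⬝ᵥ ξ ω| ∂P = ∫ ω, |u ⬝ᵥ ξ' ω| ∂P'

/-- An integrable random vector is swap-invariant if all random vectors obtained by permutations
of its coordinates are zonoid equivalent. -/
def SwapInvariantVector {Ω : Type*} [MeasurableSpace Ω] {d : ℕ}
    (ξ : Ω → Fin d → ℝ) (P : Measure Ω) : Prop :=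
  IntegrableVector ξ P ∧
    ∀ σ τ : Equiv.Perm (Fin d),
      ZonoidEquivalent (fun ω i => ξ ω (σ i)) P (fun ω i => ξ ω (τ i)) P

/-- A sequence of integrable random variables is swap-invariant if all its finite subsequences
`(ξ_{k_1}, …, ξ_{k_d})`, `k_1 < ⋯ < k_d`, are swap-invariant. -/
def SwapInvariant {Ω : Type*} [MeasurableSpace Ω]
    (ξ : ℕ → Ω → ℝ) (P : Measure Ω) : Prop :=
  (∀ n, Integrable (ξ n) P) ∧
    ∀ (d : ℕ) (k : Fin d → ℕ), StrictMono k →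
      SwapInvariantVector (fun ω i => ξ (k i) ω) P

/-!
A swap-invariant sequence becomes stationary after a change of measure, and the strong law then
follows from the pointwise ergodic theorem.

Fix `j` and let `Q` be the finite measure with density `|ξ j|` with respect to `P`. For
integrable `U`, the function `t ↦ E |t ξ j + U|` equals `t ↦ ∫ |t + U / ξ j| dQ` up to an additive
constant, which comes from the event `ξ j = 0`
(`integral_abs_add_div_withDensity_enorm`). The right derivative of the latter function
gives the law of `U / ξ j` under `Q` (`MeasureTheory.Measure.ext_of_integral_abs_add`). With `U` a
linear combination of `ξ (j + 1), ξ (j + 2), …`, swap-invariance under permutations which fix the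
index `j`, together with the Cramér–Wold device (`map_eq_of_forall_map_sum_eq`), shows that the
ratios `ξ (j + 1 + i) / ξ j` form a stationary sequence under `Q`. These ratios are `Q`-integrable,
since `∫ |ξ m / ξ j| dQ ≤ E |ξ m|`.

Birkhoff's ergodic theorem for the shift on the path space therefore makes the averages of the
ratios converge `Q`-almost surely, that is, the averages of `ξ` converge `P`-almost surely on the
event `ξ j ≠ 0`. Where all `ξ j` vanish there is nothing to prove. Swap-invariance of pairs
makes `E |ξ i|` independent of `i`, so the limit is integrable by Fatou's lemma.

The ergodic theorem `ae_exists_tendsto_birkhoffSum_div` is deduced from the maximal ergodic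
inequality, applied on the invariant sets where the upper limit of the averages exceeds `b` and
their lower limit is below `a`, with `a < b`.
-/

/-! ### The pointwise ergodic theorem -/

section Birkhoff

variable {α : Type*} {T : α → α} {g : α → ℝ}

/-- The running maximum `max_{0 ≤ k ≤ n} S_k` of the Birkhoff sums of `g` along `T`, defined
through the recursion `max_{k ≤ n + 1} S_k = max 0 (g + (max_{k ≤ n} S_k) ∘ T)`. -/
def birkhoffRunningMax (T : α → α) (g : α → ℝ) : ℕ → α → ℝ
  | 0 => fun _ => 0
  | n + 1 => fun x => max 0 (g x + birkhoffRunningMax T g n (T x))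

theorem birkhoffRunningMax_nonneg (n : ℕ) (x : α) : 0 ≤ birkhoffRunningMax T g n x := by
  cases n with
  | zero => exact le_rfl
  | succ n => exact le_max_left _ _

theorem birkhoffRunningMax_le_succ (n : ℕ) (x : α) :
    birkhoffRunningMax T g n x ≤ birkhoffRunningMax T g (n + 1) x := by
  induction n generalizing x with
  | zero => exact birkhoffRunningMax_nonneg 1 x
  | succ n ih => exact max_le_max le_rfl (add_le_add le_rfl (ih (T x)))

theorem birkhoffSum_le_birkhoffRunningMax (n : ℕ) (x : α) :
    birkhoffSum T g n x ≤ birkhoffRunningMax T g n x := by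
  induction n generalizing x with
  | zero => simp [birkhoffRunningMax]
  | succ n ih =>
    rw [birkhoffSum_succ']
    exact (add_le_add le_rfl (ih (T x))).trans (le_max_right _ _)

theorem exists_birkhoffSum_pos_of_birkhoffRunningMax_pos (n : ℕ) (x : α)
    (h : 0 < birkhoffRunningMax T g n x) : ∃ k, 0 < birkhoffSum T g k x := by
  suffices H : ∀ n x, ∃ k, birkhoffRunningMax T g n x ≤ birkhoffSum T g k x by
    obtain ⟨k, hk⟩ := H n x
    exact ⟨k, h.trans_le hk⟩
  intro n
  induction n with
  | zero => exact fun x => ⟨0, by simp [birkhoffRunningMax]⟩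
  | succ n ih =>
    intro x
    obtain ⟨k, hk⟩ := ih (T x)
    rcases le_total (g x + birkhoffRunningMax T g n (T x)) 0 with h0 | h0
    · exact ⟨0, by simp [birkhoffRunningMax, h0]⟩
    · refine ⟨k + 1, ?_⟩
      rw [birkhoffSum_succ']
      simpa [birkhoffRunningMax, h0] using hk

theorem measurable_birkhoffRunningMax
    [MeasurableSpace α] (hT : Measurable T) (hg : Measurable g) (n : ℕ) :
    Measurable (birkhoffRunningMax T g n) := by
  induction n with
  | zero => exact measurable_const
  | succ n ih => exact measurable_const.max (hg.add (ih.comp hT))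

theorem integrable_birkhoffRunningMax
    [MeasurableSpace α] {μ : Measure α} [IsFiniteMeasure μ] (hT : MeasurePreserving T μ μ)
    (hi : Integrable g μ) (n : ℕ) : Integrable (birkhoffRunningMax T g n) μ := by
  induction n with
  | zero => exact integrable_const 0
  | succ n ih => exact (integrable_const (0 : ℝ)).sup (hi.add (hT.integrable_comp_of_integrable ih))

/-- The maximal ergodic inequality. -/
theorem setIntegral_birkhoffRunningMax_pos_nonneg
    [MeasurableSpace α] {μ : Measure α} [IsFiniteMeasure μ]
    (hT : MeasurePreserving T μ μ) (hg : Measurable g) (hi : Integrable g μ) (n : ℕ) :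
    0 ≤ ∫ x in {x | 0 < birkhoffRunningMax T g n x}, g x ∂μ := by
  have hM := integrable_birkhoffRunningMax hT hi n
  have hmeas : MeasurableSet {x | 0 < birkhoffRunningMax T g n x} :=
    measurableSet_lt measurable_const (measurable_birkhoffRunningMax hT.measurable hg n)
  have hMT : ∫ x, birkhoffRunningMax T g n (T x) ∂μ = ∫ x, birkhoffRunningMax T g n x ∂μ := by
    conv_rhs => rw [← hT.map_eq]
    rw [integral_map hT.measurable.aemeasurable]
    exact (measurable_birkhoffRunningMax hT.measurable hg n).aestronglyMeasurable
  have key : ∫ x, birkhoffRunningMax T g n x ∂μ ≤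
      ∫ x, ({x | 0 < birkhoffRunningMax T g n x}.indicator g x
        + birkhoffRunningMax T g n (T x)) ∂μ := by
    refine integral_mono hM ((hi.indicator hmeas).add (hT.integrable_comp_of_integrable hM))
      fun x => ?_
    by_cases hx : 0 < birkhoffRunningMax T g n x
    · have hx' : x ∈ {x | 0 < birkhoffRunningMax T g n x} := hx
      simp only [Set.indicator_of_mem hx']
      cases n with
      | zero => exact absurd hx (lt_irrefl _)
      | succ n =>
        have h1 : birkhoffRunningMax T g (n + 1) x = g x + birkhoffRunningMax T g n (T x) := by
          rcases max_choice 0 (g x + birkhoffRunningMax T g n (T x)) with h | h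
          · exact absurd h hx.ne'
          · exact h
        rw [h1]
        exact add_le_add le_rfl (birkhoffRunningMax_le_succ n (T x))
    · have hx' : x ∉ {x | 0 < birkhoffRunningMax T g n x} := hx
      simp only [Set.indicator_of_notMem hx', zero_add]
      exact (not_lt.1 hx).trans (birkhoffRunningMax_nonneg n _)
  have hMi : Integrable (fun x => birkhoffRunningMax T g n (T x)) μ :=
    hT.integrable_comp_of_integrable hM
  rw [integral_add (hi.indicator hmeas) hMi, hMT,
    integral_indicator hmeas] at key
  linarith

/-- If every point of an invariant set has a positive Birkhoff sum, then the integral over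
that set is nonnegative: the sets where the running maxima are positive exhaust it. -/
theorem setIntegral_nonneg_of_forall_exists_birkhoffSum_pos
    [MeasurableSpace α] {μ : Measure α} [IsFiniteMeasure μ]
    (hT : MeasurePreserving T μ μ) (hg : Measurable g) (hi : Integrable g μ) {A : Set α}
    (hA : MeasurableSet A) (hTA : T ⁻¹' A = A) (h : ∀ x ∈ A, ∃ n, 0 < birkhoffSum T g n x) :
    0 ≤ ∫ x in A, g x ∂μ := by
  have hTr : MeasurePreserving T (μ.restrict A) (μ.restrict A) := by
    simpa only [hTA] using hT.restrict_preimage hA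
  set B : ℕ → Set α := fun n => {x | 0 < birkhoffRunningMax T g n x} with hB
  have hBm : ∀ n, MeasurableSet (B n) := fun n =>
    measurableSet_lt measurable_const (measurable_birkhoffRunningMax hT.measurable hg n)
  have hmono : Monotone B := monotone_nat_of_le_succ fun n x hx =>
    lt_of_lt_of_le hx (birkhoffRunningMax_le_succ n x)
  have hlim := tendsto_setIntegral_of_monotone (μ := μ.restrict A) hBm hmono
    (hi.restrict.integrableOn)
  have hAB : A ⊆ ⋃ n, B n := fun x hx => by
    obtain ⟨n, hn⟩ := h x hx
    exact Set.mem_iUnion.2 ⟨n, hn.trans_le (birkhoffSum_le_birkhoffRunningMax n x)⟩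
  rw [Measure.restrict_restrict (MeasurableSet.iUnion hBm), Set.inter_eq_right.2 hAB] at hlim
  exact ge_of_tendsto' hlim fun n =>
    setIntegral_birkhoffRunningMax_pos_nonneg hTr hg hi.restrict n

/-- The set of points at which the upper limit of the Birkhoff averages of `g` exceeds `b`.
It is written with frequently satisfied inequalities, so that an infinite upper limit
is covered. -/
def birkhoffLimsupGt (T : α → α) (g : α → ℝ) (b : ℝ) : Set α :=
  {x | ∃ c : ℚ, b < c ∧ ∃ᶠ n : ℕ in atTop, (c : ℝ) * n < birkhoffSum T g n x}

theorem measurable_birkhoffSum [MeasurableSpace α] (hT : Measurable T) (hg : Measurable g) (n : ℕ) :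
    Measurable (birkhoffSum T g n) := by
  unfold birkhoffSum
  exact Finset.measurable_fun_sum _ fun k _ => hg.comp (hT.iterate k)

theorem measurableSet_birkhoffLimsupGt
    [MeasurableSpace α] (hT : Measurable T) (hg : Measurable g) (b : ℝ) :
    MeasurableSet (birkhoffLimsupGt T g b) := by
  have : birkhoffLimsupGt T g b = ⋃ c : ℚ, ⋃ _ : b < c, ⋂ m : ℕ, ⋃ n : ℕ, ⋃ _ : m ≤ n,
      {x | (c : ℝ) * n < birkhoffSum T g n x} := by
    ext x
    simp [birkhoffLimsupGt, frequently_atTop]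
  rw [this]
  exact MeasurableSet.iUnion fun c => MeasurableSet.iUnion fun _ => MeasurableSet.iInter fun m =>
    MeasurableSet.iUnion fun n => MeasurableSet.iUnion fun _ =>
      measurableSet_lt measurable_const (measurable_birkhoffSum hT hg n)

/-- Passing from `x` to `T x` changes the Birkhoff sums by a shift of the index and the
constant `g x`, which is absorbed by lowering the rational threshold. -/
theorem preimage_birkhoffLimsupGt (b : ℝ) :
    T ⁻¹' birkhoffLimsupGt T g b = birkhoffLimsupGt T g b := by
  have shift : ∀ p : ℕ → Prop, (∃ᶠ n in atTop, p (n + 1)) ↔ ∃ᶠ n in atTop, p n := fun p => by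
    conv_rhs => rw [← map_add_atTop_eq_nat 1, frequently_map]
  have large : ∀ r s : ℝ, 0 < r → ∀ᶠ n : ℕ in atTop, s < r * n := fun r s hr =>
    (tendsto_natCast_atTop_atTop.const_mul_atTop hr).eventually_gt_atTop s
  ext x
  constructor
  · rintro ⟨c, hbc, hf⟩
    obtain ⟨d, hbd, hdc⟩ := exists_rat_btwn hbc
    refine ⟨d, hbd, (shift _).1 ?_⟩
    refine (hf.and_eventually (large (c - d) (d - g x) (sub_pos.2 hdc))).mono ?_
    rintro n ⟨h1, h2⟩
    rw [birkhoffSum_succ']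
    push_cast
    linarith
  · rintro ⟨c, hbc, hf⟩
    obtain ⟨d, hbd, hdc⟩ := exists_rat_btwn hbc
    refine ⟨d, hbd, ?_⟩
    refine (((shift _).2 hf).and_eventually
      (large (c - d) (g x - c) (sub_pos.2 hdc))).mono ?_
    rintro n ⟨h1, h2⟩
    rw [birkhoffSum_succ'] at h1
    push_cast at h1
    linarith

theorem exists_birkhoffSum_sub_const_pos {b : ℝ} {x : α} (hx : x ∈ birkhoffLimsupGt T g b) :
    ∃ n, 0 < birkhoffSum T (fun y => g y - b) n x := by
  obtain ⟨c, hbc, hf⟩ := hx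
  obtain ⟨n, hn⟩ := hf.exists
  refine ⟨n, ?_⟩
  have h1 : birkhoffSum T (fun y => g y - b) n x = birkhoffSum T g n x - n * b := by
    simp [birkhoffSum, Finset.sum_sub_distrib]
  have h2 : b * n ≤ c * n := mul_le_mul_of_nonneg_right hbc.le n.cast_nonneg
  rw [h1]
  linarith

theorem mul_measureReal_le_setIntegral_of_subset_birkhoffLimsupGt
    [MeasurableSpace α] {μ : Measure α} [IsFiniteMeasure μ]
    (hT : MeasurePreserving T μ μ) (hg : Measurable g) (hi : Integrable g μ) {A : Set α}
    (hA : MeasurableSet A) (hTA : T ⁻¹' A = A) {b : ℝ} (h : A ⊆ birkhoffLimsupGt T g b) :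
    b * μ.real A ≤ ∫ x in A, g x ∂μ := by
  have h0 := setIntegral_nonneg_of_forall_exists_birkhoffSum_pos hT (hg.sub_const b)
    (hi.sub (integrable_const b)) hA hTA fun x hx => exists_birkhoffSum_sub_const_pos (h hx)
  rw [integral_sub hi.restrict (integrable_const b), setIntegral_const, smul_eq_mul] at h0
  linarith

/-- The upper limit of the Birkhoff averages is almost everywhere less than `∞`. -/
theorem ae_exists_notMem_birkhoffLimsupGt [MeasurableSpace α] {μ : Measure α} [IsFiniteMeasure μ]
    (hT : MeasurePreserving T μ μ) (hg : Measurable g) (hi : Integrable g μ) :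
    ∀ᵐ x ∂μ, ∃ b : ℕ, x ∉ birkhoffLimsupGt T g b := by
  set A : Set α := ⋂ b : ℕ, birkhoffLimsupGt T g b with hAdef
  have hA : MeasurableSet A :=
    MeasurableSet.iInter fun b => measurableSet_birkhoffLimsupGt hT.measurable hg b
  have hTA : T ⁻¹' A = A := by
    simp only [hAdef, Set.preimage_iInter, preimage_birkhoffLimsupGt]
  have hle : ∀ b : ℕ, (b : ℝ) * μ.real A ≤ ∫ x in A, g x ∂μ := fun b =>
    mul_measureReal_le_setIntegral_of_subset_birkhoffLimsupGt hT hg hi hA hTA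
      (Set.iInter_subset _ b)
  have hzero : μ A = 0 := by
    by_contra hne
    have hpos : 0 < μ.real A := ENNReal.toReal_pos hne (measure_ne_top μ A)
    obtain ⟨b, hb⟩ := exists_nat_gt ((∫ x in A, g x ∂μ) / μ.real A)
    rw [div_lt_iff₀ hpos] at hb
    exact absurd (hle b) (not_le.2 hb)
  filter_upwards [compl_mem_ae_iff.2 hzero] with x hx
  simpa [hAdef] using hx

/-- The upper and lower limits of the Birkhoff averages are almost everywhere not separated
by `a < b`. -/
theorem measure_birkhoffLimsupGt_inter_eq_zero
    [MeasurableSpace α] {μ : Measure α} [IsFiniteMeasure μ]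
    (hT : MeasurePreserving T μ μ) (hg : Measurable g) (hi : Integrable g μ) {a b : ℝ}
    (hab : a < b) : μ (birkhoffLimsupGt T g b ∩ birkhoffLimsupGt T (-g) (-a)) = 0 := by
  set A := birkhoffLimsupGt T g b ∩ birkhoffLimsupGt T (-g) (-a) with hAdef
  have hA : MeasurableSet A := (measurableSet_birkhoffLimsupGt hT.measurable hg b).inter
    (measurableSet_birkhoffLimsupGt hT.measurable hg.neg (-a))
  have hTA : T ⁻¹' A = A := by
    simp only [hAdef, Set.preimage_inter, preimage_birkhoffLimsupGt]
  have h1 := mul_measureReal_le_setIntegral_of_subset_birkhoffLimsupGt hT hg hi hA hTA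
    Set.inter_subset_left
  have h2 := mul_measureReal_le_setIntegral_of_subset_birkhoffLimsupGt hT hg.neg hi.neg hA hTA
    Set.inter_subset_right
  simp only [Pi.neg_apply, integral_neg] at h2
  by_contra hne
  have hpos : 0 < μ.real A := ENNReal.toReal_pos hne (measure_ne_top μ A)
  nlinarith

/-- **Birkhoff's pointwise ergodic theorem**, without the identification of the limit. -/
theorem ae_exists_tendsto_birkhoffSum_div [MeasurableSpace α] {μ : Measure α} [IsFiniteMeasure μ]
    (hT : MeasurePreserving T μ μ) (hg : Measurable g) (hi : Integrable g μ) :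
    ∀ᵐ x ∂μ, ∃ c : ℝ, Tendsto (fun n : ℕ => (n : ℝ)⁻¹ * birkhoffSum T g n x) atTop (𝓝 c) := by
  have hsep : ∀ᵐ x ∂μ, ∀ a b : ℚ, (a : ℝ) < b →
      x ∉ birkhoffLimsupGt T g b ∩ birkhoffLimsupGt T (-g) (-a) := by
    rw [ae_all_iff]
    intro a
    rw [ae_all_iff]
    intro b
    by_cases hab : (a : ℝ) < b
    · filter_upwards [compl_mem_ae_iff.2
        (measure_birkhoffLimsupGt_inter_eq_zero hT hg hi hab)] with x hx _ using hx
    · exact ae_of_all _ fun x h => absurd h hab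
  have hneg : ∀ (n : ℕ) (x : α), birkhoffSum T (-g) n x = -birkhoffSum T g n x := fun n x => by
    simp [birkhoffSum]
  filter_upwards [hsep, ae_exists_notMem_birkhoffLimsupGt hT hg hi,
    ae_exists_notMem_birkhoffLimsupGt hT hg.neg hi.neg] with x hx hup hlow
  refine tendsto_of_no_upcrossings (s := Set.range ((↑) : ℚ → ℝ)) Rat.denseRange_cast ?_ ?_ ?_
  · rintro _ ⟨a, rfl⟩ _ ⟨b, rfl⟩ hab ⟨hfa, hfb⟩
    obtain ⟨a', haa', ha'b⟩ := exists_rat_btwn hab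
    obtain ⟨b', ha'b', hb'b⟩ := exists_rat_btwn ha'b
    refine hx a' b' ha'b' ⟨⟨b, hb'b, ?_⟩, ⟨-a, by push_cast; linarith, ?_⟩⟩
    · refine (hfb.and_eventually (eventually_gt_atTop 0)).mono ?_
      rintro n ⟨h, hn⟩
      have hn' : (0 : ℝ) < n := Nat.cast_pos.2 hn
      rwa [inv_mul_eq_div, lt_div_iff₀ hn'] at h
    · refine (hfa.and_eventually (eventually_gt_atTop 0)).mono ?_
      rintro n ⟨h, hn⟩
      have hn' : (0 : ℝ) < n := Nat.cast_pos.2 hn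
      rw [inv_mul_eq_div, div_lt_iff₀ hn'] at h
      rw [hneg]
      push_cast
      linarith
  · obtain ⟨b, hb⟩ := hup
    simp only [birkhoffLimsupGt, Set.mem_ofPred_eq, not_exists, not_and, not_frequently,
      not_lt] at hb
    have := hb (b + 1) (by push_cast; linarith)
    refine ⟨b + 1, eventually_map.2 ?_⟩
    filter_upwards [this, eventually_gt_atTop 0] with n h hn
    have hn' : (0 : ℝ) < n := Nat.cast_pos.2 hn
    rw [inv_mul_eq_div, div_le_iff₀ hn']
    exact_mod_cast h
  · obtain ⟨b, hb⟩ := hlow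
    simp only [birkhoffLimsupGt, Set.mem_ofPred_eq, not_exists, not_and, not_frequently,
      not_lt] at hb
    have := hb (b + 1) (by push_cast; linarith)
    refine ⟨-(b + 1), eventually_map.2 ?_⟩
    filter_upwards [this, eventually_gt_atTop 0] with n h hn
    have hn' : (0 : ℝ) < n := Nat.cast_pos.2 hn
    rw [hneg] at h
    push_cast at h
    rw [ge_iff_le, inv_mul_eq_div, le_div_iff₀ hn']
    linarith

end Birkhoff

/-! ### Laws determined by absolute moments -/

/-- The function `t ↦ ∫ |t + y| dμ(y)`, up to an additive constant, determines a measure `μ` of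
given mass, since its right derivative at `-a` is `μ [a, ∞) - μ (-∞, a)`. -/
theorem MeasureTheory.Measure.ext_of_integral_abs_add {μ ν : Measure ℝ} [IsFiniteMeasure μ]
    [IsFiniteMeasure ν] (hμ : Integrable id μ) (hν : Integrable id ν)
    (hmass : μ.real Set.univ = ν.real Set.univ) {C : ℝ}
    (h : ∀ t : ℝ, ∫ y, |t + y| ∂μ = ∫ y, |t + y| ∂ν + C) : μ = ν := by
  refine Measure.ext_of_Ici _ _ fun a => ?_
  set s : ℝ → ℝ := fun y => 2 * (Set.Ici a).indicator 1 y - 1 with hs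
  set F : ℕ → ℝ → ℝ := fun n y =>
    ((n : ℝ) + 1) * (|((n : ℝ) + 1)⁻¹ - a + y| - |-a + y|) with hF
  have hbound : ∀ n y, ‖F n y‖ ≤ 1 := fun n y => by
    have hn : (0 : ℝ) < (n : ℝ) + 1 := n.cast_add_one_pos
    have h1 : |(|((n : ℝ) + 1)⁻¹ - a + y| - |-a + y|)| ≤ ((n : ℝ) + 1)⁻¹ := by
      refine (abs_abs_sub_abs_le_abs_sub _ _).trans_eq ?_
      rw [show ((n : ℝ) + 1)⁻¹ - a + y - (-a + y) = ((n : ℝ) + 1)⁻¹ by ring,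
        abs_of_pos (inv_pos.2 hn)]
    rw [hF, Real.norm_eq_abs, abs_mul, abs_of_pos hn]
    exact (mul_le_mul_of_nonneg_left h1 hn.le).trans_eq (mul_inv_cancel₀ hn.ne')
  have hlim : ∀ y, Tendsto (fun n => F n y) atTop (𝓝 (s y)) := fun y => by
    have hinv : Tendsto (fun n : ℕ => ((n : ℝ) + 1)⁻¹) atTop (𝓝 0) := by
      simpa using tendsto_one_div_add_atTop_nhds_zero_nat (𝕜 := ℝ)
    refine tendsto_const_nhds.congr' ?_
    rcases le_or_gt a y with hy | hy
    · refine Eventually.of_forall fun n => ?_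
      have hn : (0 : ℝ) < (n : ℝ) + 1 := n.cast_add_one_pos
      have hn' := inv_pos.2 hn
      simp only [hs, hF, Set.indicator_of_mem (Set.mem_Ici.2 hy), Pi.one_apply]
      rw [abs_of_nonneg (by linarith), abs_of_nonneg (by linarith)]
      field_simp
      ring
    · filter_upwards [hinv.eventually_lt_const (sub_pos.2 hy)] with n hlt
      have hn : (0 : ℝ) < (n : ℝ) + 1 := n.cast_add_one_pos
      have hy' : y ∉ Set.Ici a := not_le.2 hy
      simp only [hs, hF, Set.indicator_of_notMem hy']
      rw [abs_of_neg (by linarith), abs_of_neg (by linarith)]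
      field_simp
      ring
  have htend : ∀ ρ : Measure ℝ, [IsFiniteMeasure ρ] →
      Tendsto (fun n => ∫ y, F n y ∂ρ) atTop (𝓝 (∫ y, s y ∂ρ)) := fun ρ _ =>
    tendsto_integral_of_dominated_convergence (fun _ => 1)
      (fun n => by rw [hF]; fun_prop) (integrable_const 1)
      (fun n => ae_of_all _ (hbound n)) (ae_of_all _ hlim)
  have hint : ∀ ρ : Measure ℝ, [IsFiniteMeasure ρ] → Integrable id ρ → ∀ n,
      ∫ y, F n y ∂ρ = ((n : ℝ) + 1) *
        (∫ y, |((n : ℝ) + 1)⁻¹ - a + y| ∂ρ - ∫ y, |-a + y| ∂ρ) := fun ρ _ hρ n => by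
    rw [hF, integral_const_mul, integral_sub]
    · exact ((integrable_const _).add hρ).abs
    · exact ((integrable_const _).add hρ).abs
  have heq : ∀ n, ∫ y, F n y ∂μ = ∫ y, F n y ∂ν := fun n => by
    rw [hint μ hμ, hint ν hν, h, h]
    ring
  have hsint : ∀ ρ : Measure ℝ, [IsFiniteMeasure ρ] →
      ∫ y, s y ∂ρ = 2 * ρ.real (Set.Ici a) - ρ.real Set.univ := fun ρ _ => by
    have hi : Integrable (fun y => 2 * (Set.Ici a).indicator (1 : ℝ → ℝ) y) ρ :=
      ((integrable_const (1 : ℝ)).indicator measurableSet_Ici).const_mul 2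
    simp only [hs]
    rw [integral_sub hi (integrable_const 1), integral_const_mul,
      integral_indicator_one measurableSet_Ici]
    simp
  have hfin := tendsto_nhds_unique ((htend μ).congr heq) (htend ν)
  rw [hsint μ, hsint ν, hmass] at hfin
  exact (measureReal_eq_measureReal_iff).1 (by linarith)

/-- The Cramér–Wold device for sequences of random variables. -/
theorem map_eq_of_forall_map_sum_eq {Ω : Type*} [MeasurableSpace Ω] {Q : Measure Ω}
    [IsFiniteMeasure Q] {X Y : ℕ → Ω → ℝ} (hX : ∀ i, AEMeasurable (X i) Q)
    (hY : ∀ i, AEMeasurable (Y i) Q)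
    (h : ∀ (n : ℕ) (w : ℕ → ℝ), Q.map (fun ω => ∑ i ∈ Finset.range n, w i * X i ω) =
      Q.map (fun ω => ∑ i ∈ Finset.range n, w i * Y i ω)) :
    Q.map (fun ω i => X i ω) = Q.map (fun ω i => Y i ω) := by
  rw [ProbabilityTheory.map_eq_iff_forall_finset_map_restrict_eq (aemeasurable_pi_lambda _ hX)
    (aemeasurable_pi_lambda _ hY)]
  intro I
  refine Measure.ext_of_charFunDual (funext fun L => ?_)
  have hXI : AEMeasurable (fun ω => I.restrict (X · ω)) Q :=
    aemeasurable_pi_lambda _ fun i => hX i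
  have hYI : AEMeasurable (fun ω => I.restrict (Y · ω)) Q :=
    aemeasurable_pi_lambda _ fun i => hY i
  rw [charFunDual_eq_charFun_map_one, charFunDual_eq_charFun_map_one,
    AEMeasurable.map_map_of_aemeasurable (by fun_prop) hXI,
    AEMeasurable.map_map_of_aemeasurable (by fun_prop) hYI]
  -- The functional `L` becomes a linear combination of an initial segment of the coordinates.
  set w : ℕ → ℝ := fun i => if hi : i ∈ I then L (Pi.single ⟨i, hi⟩ 1) else 0 with hw
  obtain ⟨n, hn⟩ : ∃ n, I ⊆ Finset.range n := I.exists_nat_subset_range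
  have hL : ∀ y : ℕ → ℝ, L (I.restrict y) = ∑ i ∈ Finset.range n, w i * y i := fun y => by
    rw [← Finset.sum_subset hn fun i _ hi => by simp [hw, hi], ← Finset.sum_coe_sort]
    conv_lhs => rw [← Finset.univ_sum_single (I.restrict y)]
    rw [map_sum]
    refine Finset.sum_congr rfl fun i _ => ?_
    have h1 : (Pi.single i (I.restrict y i) : I → ℝ) = y i • Pi.single i 1 := by
      rw [← Pi.single_smul]
      simp
    rw [h1, map_smul, smul_eq_mul, mul_comm]
    simp [hw]
  have hXL : (L ∘ fun ω => I.restrict (X · ω)) =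
      fun ω => ∑ i ∈ Finset.range n, w i * X i ω := funext fun ω => hL _
  have hYL : (L ∘ fun ω => I.restrict (Y · ω)) =
      fun ω => ∑ i ∈ Finset.range n, w i * Y i ω := funext fun ω => hL _
  rw [hXL, hYL, h n w]

/-! ### Averages of stationary sequences -/

/-- If an integrable sequence has the same law as its shift, then its averages converge almost
surely: this is the ergodic theorem for the shift on the path space. -/
theorem ae_exists_tendsto_average_of_map_shift_eq {Ω : Type*} [MeasurableSpace Ω] {Q : Measure Ω}
    [IsFiniteMeasure Q] {Y : ℕ → Ω → ℝ} (hY : ∀ i, AEMeasurable (Y i) Q)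
    (hint : Integrable (Y 0) Q)
    (hshift : Q.map (fun ω i => Y (i + 1) ω) = Q.map (fun ω i => Y i ω)) :
    ∀ᵐ ω ∂Q, ∃ c : ℝ,
      Tendsto (fun n : ℕ => (n : ℝ)⁻¹ * ∑ i ∈ Finset.range n, Y i ω) atTop (𝓝 c) := by
  have hΦ : AEMeasurable (fun ω i => Y i ω) Q := aemeasurable_pi_lambda _ hY
  set T : (ℕ → ℝ) → ℕ → ℝ := fun y i => y (i + 1) with hTdef
  have hTm : Measurable T := measurable_pi_lambda _ fun i => measurable_pi_apply (i + 1)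
  have hT : MeasurePreserving T (Q.map fun ω i => Y i ω) (Q.map fun ω i => Y i ω) := by
    refine ⟨hTm, ?_⟩
    rw [AEMeasurable.map_map_of_aemeasurable hTm.aemeasurable hΦ]
    exact hshift
  have hg : Measurable fun y : ℕ → ℝ => y 0 := measurable_pi_apply 0
  have hgi : Integrable (fun y : ℕ → ℝ => y 0) (Q.map fun ω i => Y i ω) :=
    (integrable_map_measure hg.aestronglyMeasurable hΦ).2 hint
  have hiter : ∀ (k : ℕ) (y : ℕ → ℝ) (i : ℕ), T^[k] y i = y (i + k) := fun k => by
    induction k with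
    | zero => exact fun _ _ => rfl
    | succ k ih =>
      intro y i
      rw [Function.iterate_succ_apply, ih]
      exact congrArg y (add_assoc i k 1)
  filter_upwards [ae_of_ae_map hΦ (ae_exists_tendsto_birkhoffSum_div hT hg hgi)] with ω hω
  simpa [birkhoffSum, hiter] using hω

/-- The convergence of averages and the limit depend only on the tail of a sequence. -/
theorem tendsto_average_of_tendsto_average_add {a : ℕ → ℝ} {m : ℕ} {c : ℝ}
    (h : Tendsto (fun n : ℕ => (n : ℝ)⁻¹ * ∑ i ∈ Finset.range n, a (m + i)) atTop (𝓝 c)) :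
    Tendsto (fun n : ℕ => (n : ℝ)⁻¹ * ∑ i ∈ Finset.range n, a i) atTop (𝓝 c) := by
  rw [← tendsto_add_atTop_iff_nat m]
  have hcast : Tendsto (fun n : ℕ => (n : ℝ) + m) atTop atTop :=
    tendsto_atTop_add_const_right _ _ tendsto_natCast_atTop_atTop
  have h0 : Tendsto (fun n : ℕ => ((n : ℝ) + m)⁻¹ * ∑ i ∈ Finset.range m, a i) atTop (𝓝 0) := by
    simpa using hcast.inv_tendsto_atTop.mul_const (∑ i ∈ Finset.range m, a i)
  have h1 : Tendsto (fun n : ℕ => (n : ℝ) / (n + m)) atTop (𝓝 1) :=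
    tendsto_natCast_div_add_atTop (m : ℝ)
  have h2 := h0.add (h1.mul h)
  rw [zero_add, one_mul] at h2
  refine h2.congr' ?_
  filter_upwards [eventually_gt_atTop 0] with n hn
  have hn' : (n : ℝ) ≠ 0 := Nat.cast_ne_zero.2 hn.ne'
  rw [add_comm n m, Finset.sum_range_add]
  push_cast
  rw [add_comm (m : ℝ) n]
  field_simp

/-! ### Zonoid equivalence and the change of measure -/

section ChangeOfMeasure

variable {Ω : Type*} [MeasurableSpace Ω] {P : Measure Ω}

theorem isFiniteMeasure_withDensity_enorm {Z : Ω → ℝ} (hZ : Integrable Z P) :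
    IsFiniteMeasure (P.withDensity fun ω => ‖Z ω‖ₑ) :=
  isFiniteMeasure_withDensity hZ.hasFiniteIntegral.ne

theorem integral_withDensity_enorm {Z : Ω → ℝ} (hZ : Integrable Z P) (f : Ω → ℝ) :
    ∫ ω, f ω ∂(P.withDensity fun ω => ‖Z ω‖ₑ) = ∫ ω, |Z ω| * f ω ∂P := by
  rw [integral_withDensity_eq_integral_toReal_smul₀ hZ.aestronglyMeasurable.enorm
    (ae_of_all _ fun ω => enorm_lt_top)]
  simp

theorem integrable_div_withDensity_enorm {Z U : Ω → ℝ} (hZ : Integrable Z P)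
    (hU : Integrable U P) :
    Integrable (fun ω => U ω / Z ω) (P.withDensity fun ω => ‖Z ω‖ₑ) := by
  rw [integrable_withDensity_iff_integrable_smul₀' hZ.aestronglyMeasurable.enorm
    (ae_of_all _ fun ω => enorm_lt_top)]
  refine hU.abs.mono' ?_ (ae_of_all _ fun ω => ?_)
  · exact hZ.aestronglyMeasurable.enorm.ennreal_toReal.aestronglyMeasurable.smul
      (hU.aemeasurable.div hZ.aemeasurable).aestronglyMeasurable
  · by_cases h : Z ω = 0
    · simp [h]
    · have h' : |Z ω| ≠ 0 := abs_ne_zero.2 h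
      simp only [toReal_enorm, Real.norm_eq_abs, smul_eq_mul, abs_mul, abs_abs, abs_div]
      rw [mul_div_cancel₀ _ h']

/-- Tilting by `|Z|` turns `E |t Z + U|` into the absolute moment of `t + U / Z`. The event
`Z = 0`, which the tilted measure does not see, contributes a term independent of `t`. -/
theorem integral_abs_add_div_withDensity_enorm {Z U : Ω → ℝ} (hZ : Integrable Z P)
    (hU : Integrable U P) (t : ℝ) :
    ∫ ω, |t + U ω / Z ω| ∂(P.withDensity fun ω => ‖Z ω‖ₑ) =
      ∫ ω, |t * Z ω + U ω| ∂P - ∫ ω, (|U ω| - |Z ω| * |U ω / Z ω|) ∂P := by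
  have hi : Integrable (fun ω => |Z ω| * |U ω / Z ω|) P := by
    have h := (integrable_withDensity_iff_integrable_smul₀' hZ.aestronglyMeasurable.enorm
      (ae_of_all _ fun ω => enorm_lt_top)).1 (integrable_div_withDensity_enorm hZ hU).abs
    simpa using h
  have ht : Integrable (fun ω => |t * Z ω + U ω|) P := ((hZ.const_mul t).add hU).abs
  have hd : Integrable (fun ω => |U ω| - |Z ω| * |U ω / Z ω|) P := hU.abs.sub hi
  rw [integral_withDensity_enorm hZ, ← integral_sub ht hd]
  refine integral_congr_ae (ae_of_all _ fun ω => ?_)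
  dsimp only
  by_cases h : Z ω = 0
  · simp [h]
  · rw [← abs_mul, ← abs_mul, mul_div_cancel₀ _ h, sub_self, sub_zero, mul_add,
      mul_div_cancel₀ _ h, mul_comm]

theorem map_div_withDensity_enorm_eq {Z U V : Ω → ℝ} (hZ : Integrable Z P)
    (hU : Integrable U P) (hV : Integrable V P)
    (h : ∀ t : ℝ, ∫ ω, |t * Z ω + U ω| ∂P = ∫ ω, |t * Z ω + V ω| ∂P) :
    (P.withDensity fun ω => ‖Z ω‖ₑ).map (fun ω => U ω / Z ω) =
      (P.withDensity fun ω => ‖Z ω‖ₑ).map (fun ω => V ω / Z ω) := by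
  have := isFiniteMeasure_withDensity_enorm hZ
  have hUi := integrable_div_withDensity_enorm hZ hU
  have hVi := integrable_div_withDensity_enorm hZ hV
  refine Measure.ext_of_integral_abs_add
    ((integrable_map_measure aestronglyMeasurable_id hUi.aemeasurable).2 hUi)
    ((integrable_map_measure aestronglyMeasurable_id hVi.aemeasurable).2 hVi) ?_
    (C := ∫ ω, (|V ω| - |Z ω| * |V ω / Z ω|) ∂P - ∫ ω, (|U ω| - |Z ω| * |U ω / Z ω|) ∂P)
    fun t => ?_
  · simp only [measureReal_def]
    rw [Measure.map_apply_of_aemeasurable hUi.aemeasurable MeasurableSet.univ,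
      Measure.map_apply_of_aemeasurable hVi.aemeasurable MeasurableSet.univ]
    simp
  · rw [integral_map hUi.aemeasurable (by fun_prop), integral_map hVi.aemeasurable (by fun_prop),
      integral_abs_add_div_withDensity_enorm hZ hU, integral_abs_add_div_withDensity_enorm hZ hV,
      h t]
    ring

end ChangeOfMeasure

/-! ### Swap-invariant sequences -/

section SwapInvariant

variable {Ω : Type*} [MeasurableSpace Ω] {P : Measure Ω} {ξ : ℕ → Ω → ℝ}

theorem SwapInvariant.integral_abs_sum_perm (hξ : SwapInvariant ξ P) {d : ℕ} {k : Fin d → ℕ}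
    (hk : StrictMono k) (τ : Equiv.Perm (Fin d)) (u : Fin d → ℝ) :
    ∫ ω, |∑ i, u i * ξ (k i) ω| ∂P = ∫ ω, |∑ i, u i * ξ (k (τ i)) ω| ∂P := by
  simpa [dotProduct] using ((hξ.2 d k hk).2 (Equiv.refl _) τ).integral_abs_eq u

/-- Absolute moments of linear combinations do not change when all indices but the first
are shifted. -/
theorem SwapInvariant.integral_abs_add_sum_shift (hξ : SwapInvariant ξ P) (j n : ℕ)
    (t : ℝ) (w : ℕ → ℝ) :
    ∫ ω, |t * ξ j ω + ∑ i ∈ Finset.range n, w i * ξ (j + 1 + i) ω| ∂P =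
      ∫ ω, |t * ξ j ω + ∑ i ∈ Finset.range n, w i * ξ (j + 1 + (i + 1)) ω| ∂P := by
  -- The window of length `n + 2` starting at `j`, with the coordinates after the first rotated;
  -- the last coordinate gets weight zero.
  have h := hξ.integral_abs_sum_perm (d := n + 2) (k := fun i => j + i)
    (fun a b hab => Nat.add_lt_add_left hab j)
    (Equiv.Perm.decomposeFin.symm (0, finRotate (n + 1)))
    (Fin.cons t (Fin.snoc (fun i : Fin n => w i) 0))
  have hrot : ∀ i : Fin n, ((finRotate (n + 1) i.castSucc : Fin (n + 1)) : ℕ) = i + 1 := fun i =>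
    congrArg Fin.val (finRotate_of_lt i.2)
  simp only [Fin.sum_univ_succ (n := n + 1), Fin.sum_univ_castSucc (n := n), Fin.cons_zero,
    Fin.cons_succ, Fin.snoc_castSucc, Fin.snoc_last, zero_mul, add_zero, Fin.val_zero,
    Fin.val_succ, Fin.val_castSucc, Equiv.Perm.decomposeFin_symm_apply_zero,
    Equiv.Perm.decomposeFin_symm_apply_succ, Equiv.swap_self, Equiv.refl_apply, hrot] at h
  simp only [Finset.sum_range, add_assoc, add_comm 1]
  exact h

theorem SwapInvariant.integral_abs_eq (hξ : SwapInvariant ξ P) (i : ℕ) :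
    ∫ ω, |ξ i ω| ∂P = ∫ ω, |ξ 0 ω| ∂P := by
  induction i with
  | zero => rfl
  | succ i ih =>
    rw [← ih]
    have h := hξ.integral_abs_sum_perm (d := 2) (k := fun l => i + l)
      (fun a b hab => Nat.add_lt_add_left hab i) (Equiv.swap 0 1) ![1, 0]
    simpa [Fin.sum_univ_two] using h.symm

/-- Under the measure with density `|ξ j|`, the ratios `ξ (j + 1 + i) / ξ j` form a stationary
integrable sequence, whence the averages of `ξ` converge almost surely where `ξ j` is nonzero. -/
theorem SwapInvariant.ae_exists_tendsto_average_of_ne_zero (hξ : SwapInvariant ξ P) (j : ℕ) :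
    ∀ᵐ ω ∂P, ξ j ω ≠ 0 → ∃ c : ℝ,
      Tendsto (fun n : ℕ => (n : ℝ)⁻¹ * ∑ i ∈ Finset.range n, ξ i ω) atTop (𝓝 c) := by
  have hint := hξ.1
  have := isFiniteMeasure_withDensity_enorm (hint j)
  have hY : ∀ m, Integrable (fun ω => ξ m ω / ξ j ω) (P.withDensity fun ω => ‖ξ j ω‖ₑ) :=
    fun m => integrable_div_withDensity_enorm (hint j) (hint m)
  have hshift := map_eq_of_forall_map_sum_eq (Q := P.withDensity fun ω => ‖ξ j ω‖ₑ)
    (X := fun i ω => ξ (j + 1 + (i + 1)) ω / ξ j ω) (Y := fun i ω => ξ (j + 1 + i) ω / ξ j ω)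
    (fun i => (hY _).aemeasurable) (fun i => (hY _).aemeasurable) fun n w => by
      have h := map_div_withDensity_enorm_eq (hint j)
        (integrable_finsetSum (Finset.range n) fun i _ => (hint (j + 1 + i)).const_mul (w i))
        (integrable_finsetSum (Finset.range n)
          fun i _ => (hint (j + 1 + (i + 1))).const_mul (w i))
        fun t => hξ.integral_abs_add_sum_shift j n t w
      simpa only [Finset.sum_div, mul_div_assoc] using h.symm
  have hconv := ae_exists_tendsto_average_of_map_shift_eq
    (Y := fun i ω => ξ (j + 1 + i) ω / ξ j ω) (fun i => (hY _).aemeasurable) (hY _) hshift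
  rw [ae_withDensity_iff' (hint j).aestronglyMeasurable.enorm] at hconv
  filter_upwards [hconv] with ω hω hne
  obtain ⟨c, hc⟩ := hω (enorm_ne_zero.2 hne)
  refine ⟨c * ξ j ω, tendsto_average_of_tendsto_average_add (m := j + 1)
    ((hc.mul_const (ξ j ω)).congr fun n => ?_)⟩
  rw [← Finset.sum_div, mul_assoc, div_mul_cancel₀ _ hne]

theorem SwapInvariant.ae_exists_tendsto_average (hξ : SwapInvariant ξ P) :
    ∀ᵐ ω ∂P, ∃ c : ℝ,
      Tendsto (fun n : ℕ => (n : ℝ)⁻¹ * ∑ i ∈ Finset.range n, ξ i ω) atTop (𝓝 c) := by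
  filter_upwards [ae_all_iff.2 hξ.ae_exists_tendsto_average_of_ne_zero] with ω hω
  by_cases h : ∃ j, ξ j ω ≠ 0
  · obtain ⟨j, hj⟩ := h
    exact hω j hj
  · push Not at h
    exact ⟨0, by simp [h]⟩

theorem SwapInvariant.lintegral_enorm_average_le (hξ : SwapInvariant ξ P) (n : ℕ) :
    ∫⁻ ω, ‖(n : ℝ)⁻¹ * ∑ i ∈ Finset.range n, ξ i ω‖ₑ ∂P ≤ ENNReal.ofReal (∫ ω, |ξ 0 ω| ∂P) := by
  have hint : Integrable (fun ω => (n : ℝ)⁻¹ * ∑ i ∈ Finset.range n, ξ i ω) P :=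
    (integrable_finsetSum _ fun i _ => hξ.1 i).const_mul _
  rw [← ofReal_integral_norm_eq_lintegral_enorm hint]
  refine ENNReal.ofReal_le_ofReal ?_
  calc ∫ ω, ‖(n : ℝ)⁻¹ * ∑ i ∈ Finset.range n, ξ i ω‖ ∂P
      ≤ ∫ ω, (n : ℝ)⁻¹ * ∑ i ∈ Finset.range n, |ξ i ω| ∂P := by
        refine integral_mono hint.norm
          ((integrable_finsetSum _ fun i _ => (hξ.1 i).abs).const_mul _) fun ω => ?_
        rw [Real.norm_eq_abs, abs_mul, abs_of_nonneg (inv_nonneg.2 n.cast_nonneg)]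
        exact mul_le_mul_of_nonneg_left (Finset.abs_sum_le_sum_abs _ _)
          (inv_nonneg.2 n.cast_nonneg)
    _ = (n : ℝ)⁻¹ * (n * ∫ ω, |ξ 0 ω| ∂P) := by
        rw [integral_const_mul, integral_finsetSum _ fun i _ => (hξ.1 i).abs,
          Finset.sum_congr rfl fun i _ => hξ.integral_abs_eq i]
        simp
    _ ≤ ∫ ω, |ξ 0 ω| ∂P := by
        rw [← mul_assoc]
        exact mul_le_of_le_one_left (integral_nonneg fun ω => abs_nonneg _) inv_mul_le_one

end SwapInvariant

theorem mainTheorem1 {Ω : Type*} [MeasurableSpace Ω] (P : Measure Ω) [IsProbabilityMeasure P]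
    (ξ : ℕ → Ω → ℝ) (hξ : SwapInvariant ξ P) :
    ∃ X : Ω → ℝ, Measurable X ∧ Integrable X P ∧
      ∀ᵐ ω ∂P, Tendsto (fun n : ℕ => (n : ℝ)⁻¹ * ∑ i ∈ Finset.range n, ξ i ω) atTop (𝓝 (X ω)) := by
  have hmeas : ∀ n : ℕ, AEMeasurable (fun ω => (n : ℝ)⁻¹ * ∑ i ∈ Finset.range n, ξ i ω) P :=
    fun n => ((integrable_finsetSum _ fun i _ => hξ.1 i).const_mul _).aemeasurable
  obtain ⟨X, hX, hlim⟩ := measurable_limit_of_tendsto_metrizable_ae hmeas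
    hξ.ae_exists_tendsto_average
  refine ⟨X, hX, ⟨hX.aestronglyMeasurable, ?_⟩, hlim⟩
  -- Fatou's lemma and the common first absolute moment bound the limit.
  calc ∫⁻ ω, ‖X ω‖ₑ ∂P
      = ∫⁻ ω, liminf (fun n : ℕ => ‖(n : ℝ)⁻¹ * ∑ i ∈ Finset.range n, ξ i ω‖ₑ) atTop ∂P := by
        refine lintegral_congr_ae ?_
        filter_upwards [hlim] with ω hω using hω.enorm.liminf_eq.symm
    _ ≤ liminf (fun n : ℕ => ∫⁻ ω, ‖(n : ℝ)⁻¹ * ∑ i ∈ Finset.range n, ξ i ω‖ₑ ∂P) atTop :=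
        lintegral_liminf_le' fun n => (hmeas n).enorm
    _ ≤ liminf (fun _ : ℕ => ENNReal.ofReal (∫ ω, |ξ 0 ω| ∂P)) atTop :=
        liminf_le_liminf (Eventually.of_forall hξ.lintegral_enorm_average_le)
    _ = ENNReal.ofReal (∫ ω, |ξ 0 ω| ∂P) := liminf_const _
    _ < ⊤ := ENNReal.ofReal_lt_top
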